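/- Let $\nu,\ell>0$, let $\Omega\subset\mathbb{R}^d$ be bounded and convex, and let $\mathscr{N}_\Psi(\Omega)$ be the reproducing kernel Hilbert space on $\Omega$ of the Matérn kernel $k(x,\tilde x)=\Psi(x-\tilde x)$, where $$\Psi(x)=\frac{1}{\Gamma(\nu)2^{\nu-1}}\Bigl(\frac{\sqrt{2\nu}\,\|x\|}{\ell}\Bigr)^{\nu}K_\nu\Bigl(\frac{\sqrt{2\nu}\,\|x\|}{\ell}\Bigr),\qquad \Psi(0)=1,$$ and $K_\nu$ is the modified Bessel function of the second kind. Let $X$ be a random vector in $\Omega$ with a probability density on $\Omega$ that is bounded above and bounded below away from zero. Let $f\in\mathscr{N}_\Psi(\Omega)$ and let $\varphi:\{f(x):x\in\Omega\}\to\mathbb{R}$ be bounded (and Borel measurable). Consider an asymptotic regime in which $n\to\infty$, where $m\ge 1$ and the deterministic $\lambda>0$ may vary with the regime in any way. Let $x_1,\dots,x_n$ be i.i.d. copies of $X$ and let $y_{ij}=f(x_i)+\epsilon_{ij}$ for $1\le i\le n$, $1\le j\le m$, where, conditionally on $(x_1,\dots,x_n)$, the noise terms $\epsilon_{ij}$ are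 independent, have mean zero, are sub-Gaussian with a common variance proxy $\sigma^2$ (that is, $\mathbb{E}[e^{t\epsilon_{ij}}\mid x_1,\dots,x_n]\le e^{\sigma^2t^2/2}$ for all $t\in\mathbb{R}$), and $\epsilon_{i1},\dots,\epsilon_{im}$ are identically distributed for each $i$. Put $\bar y_i=\frac1m\sum_{j=1}^m y_{ij}$ and let $$\hat f=\operatorname*{arg\,min}_{g\in\mathscr{N}_\Psi(\Omega)}\ \frac1n\sum_{i=1}^n\bigl(\bar y_i-g(x_i)\bigr)^2+\lambda\|g\|^2_{\mathscr{N}_\Psi(\Omega)}$$ be the kernel ridge regression estimator. Then $$\left|\frac1n\sum_{i=1}^n\varphi(f(x_i))\bigl(f(x_i)-\hat f(x_i)\bigr)\right|=O_{\mathbb{P}}\bigl(\lambda^{1/2}+(mn)^{-1/2}\bigr),$$ where $a=O_{\mathbb{P}}(b)$ means that for every $\varepsilon>0$ there is $C>0$ such that $\mathbb{P}(a>Cb)<\varepsilon$ eventually in the regime. -/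

import Mathlib

open MeasureTheory ProbabilityTheory Set Filter
open scoped NNReal ENNReal Topology

noncomputable section

namespace NestedKRR

/-- Modified Bessel function of the second kind of real order `ν` at `z > 0`, by its standard integral
representation `K_ν(z) = ∫₀^∞ exp(-z cosh t) cosh(ν t) dt`. -/
def besselK (ν z : ℝ) : ℝ :=
  ∫ t in Ioi (0 : ℝ), Real.exp (-z * Real.cosh t) * Real.cosh (ν * t)

/-- The Matérn correlation function `Ψ` of smoothness `ν` and length scale `ℓ`. The formula has a
removable singularity at the origin, where its value is the limit `1`. -/
def matern {d : ℕ} (ν ℓ : ℝ) (x : EuclideanSpace ℝ (Fin d)) : ℝ :=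
  if x = 0 then 1
  else 1 / (Real.Gamma ν * 2 ^ (ν - 1)) * (√(2 * ν) * ‖x‖ / ℓ) ^ ν *
    besselK ν (√(2 * ν) * ‖x‖ / ℓ)

theorem integrableOn_maternMixture {ν : ℝ} (hν : 0 < ν) {q : ℝ} (hq : 0 ≤ q) :
    IntegrableOn (fun s : ℝ => Real.exp (-s) * s ^ (ν - 1) * Real.exp (-q / s)) (Ioi 0) := by
  refine Integrable.mono' (Real.GammaIntegral_convergent hν) (by fun_prop) ?_
  filter_upwards [ae_restrict_mem measurableSet_Ioi] with s hs
  have hs' : (0 : ℝ) < s := hs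
  have h1 : Real.exp (-q / s) ≤ 1 := by
    rw [Real.exp_le_one_iff]
    exact div_nonpos_of_nonpos_of_nonneg (by linarith) hs'.le
  rw [Real.norm_of_nonneg (by positivity)]
  exact mul_le_of_le_one_right (by positivity) h1

/-- `Ψ` as a mixture of Gaussians, first in the variable `z`. -/
theorem rpow_mul_besselK {ν z : ℝ} (hν : 0 < ν) (hz : 0 < z) :
    z ^ ν * besselK ν z = 2 ^ (ν - 1) *
      ∫ s in Ioi (0 : ℝ), Real.exp (-s) * s ^ (ν - 1) * Real.exp (-(z ^ 2 / 4) / s) := by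
  set g : ℝ → ℝ := fun s => Real.exp (-s) * s ^ (ν - 1) * Real.exp (-(z ^ 2 / 4) / s) with hg
  set h : ℝ → ℝ := fun t => Real.exp (ν * t) * Real.exp (-z * Real.cosh t) with hh
  have himg : (fun t : ℝ => z / 2 * Real.exp t) '' univ = Ioi 0 := by
    ext s
    simp only [image_univ, mem_range, mem_Ioi]
    constructor
    · rintro ⟨t, rfl⟩
      positivity
    · intro hs
      refine ⟨Real.log (s / (z / 2)), ?_⟩
      rw [Real.exp_log (by positivity)]
      field_simp
  have hder : ∀ t ∈ (univ : Set ℝ), HasDerivWithinAt (fun t : ℝ => z / 2 * Real.exp t)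
      (z / 2 * Real.exp t) univ t := fun t _ =>
    ((Real.hasDerivAt_exp t).const_mul (z / 2)).hasDerivWithinAt
  have hinj : InjOn (fun t : ℝ => z / 2 * Real.exp t) univ := by
    intro a _ b _ hab
    have : z / 2 ≠ 0 := by positivity
    exact Real.exp_injective (mul_left_cancel₀ this hab)
  have hgh : ∀ t : ℝ, |z / 2 * Real.exp t| • g (z / 2 * Real.exp t) = (z / 2) ^ ν * h t := by
    intro t
    have hpos : 0 < z / 2 * Real.exp t := by positivity
    have e1 : (z / 2 * Real.exp t) * (z / 2 * Real.exp t) ^ (ν - 1)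
        = (z / 2) ^ ν * Real.exp (ν * t) := by
      rw [mul_comm, ← Real.rpow_add_one hpos.ne', sub_add_cancel,
        Real.mul_rpow (by positivity) (by positivity), ← Real.exp_mul, mul_comm t]
    have e2 : Real.exp (-(z / 2 * Real.exp t)) *
        Real.exp (-(z ^ 2 / 4) / (z / 2 * Real.exp t)) = Real.exp (-z * Real.cosh t) := by
      rw [← Real.exp_add, Real.cosh_eq, Real.exp_neg]
      congr 1
      field_simp
      ring
    rw [abs_of_pos hpos, smul_eq_mul, hg, hh]
    calc _ = ((z / 2 * Real.exp t) * (z / 2 * Real.exp t) ^ (ν - 1)) *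
          (Real.exp (-(z / 2 * Real.exp t)) *
            Real.exp (-(z ^ 2 / 4) / (z / 2 * Real.exp t))) := by ring
      _ = _ := by rw [e1, e2]; ring
  have hc : (0 : ℝ) < (z / 2) ^ ν := by positivity
  have hgint : IntegrableOn g (Ioi 0) := integrableOn_maternMixture hν (by positivity)
  have hint : Integrable h := by
    rw [← himg, integrableOn_image_iff_integrableOn_abs_deriv_smul MeasurableSet.univ hder hinj]
      at hgint
    simp only [hgh, integrableOn_univ] at hgint
    have h1 := hgint.const_mul ((z / 2) ^ ν)⁻¹
    simp only [inv_mul_cancel_left₀ hc.ne'] at h1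
    exact h1
  have key : ∫ s in Ioi (0 : ℝ), g s = (z / 2) ^ ν * ∫ t, h t := by
    rw [← himg, integral_image_eq_integral_abs_deriv_smul MeasurableSet.univ hder hinj]
    simp only [hgh, Measure.restrict_univ]
    rw [integral_const_mul]
  have hfold : ∫ t, h t = 2 * besselK ν z := by
    rw [← intervalIntegral.integral_Iic_add_Ioi (b := 0) hint.integrableOn hint.integrableOn]
    have : ∫ t in Iic (0 : ℝ), h t = ∫ t in Ioi (0 : ℝ), h (-t) := by
      have := integral_comp_neg_Ioi (0 : ℝ) h
      simpa only [neg_zero] using this.symm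
    rw [this, ← integral_add _ hint.integrableOn, besselK, ← integral_const_mul]
    · refine integral_congr_ae (Eventually.of_forall fun t => ?_)
      simp only [hh, Real.cosh_neg]
      rw [Real.cosh_eq (ν * t)]
      ring_nf
    · exact (hint.comp_neg).integrableOn
  rw [key, hfold, Real.div_rpow hz.le (by norm_num), Real.rpow_sub_one (by norm_num)]
  have : (2 : ℝ) ^ ν ≠ 0 := by positivity
  field_simp

theorem matern_eq_mixture {d : ℕ} {ν ℓ : ℝ} (hν : 0 < ν) (hℓ : 0 < ℓ)
    (x : EuclideanSpace ℝ (Fin d)) :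
    matern ν ℓ x = (Real.Gamma ν)⁻¹ * ∫ s in Ioi (0 : ℝ), Real.exp (-s) * s ^ (ν - 1) *
      Real.exp (-(ν * ‖x‖ ^ 2 / (2 * ℓ ^ 2)) / s) := by
  have hG : 0 < Real.Gamma ν := Real.Gamma_pos_of_pos hν
  rw [matern]
  split_ifs with hx
  · subst hx
    simp [← Real.Gamma_eq_integral hν, hG.ne']
  · have hx' : 0 < ‖x‖ := norm_pos_iff.mpr hx
    have hz : 0 < √(2 * ν) * ‖x‖ / ℓ := by positivity
    rw [mul_assoc, rpow_mul_besselK hν hz]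
    have e : (√(2 * ν) * ‖x‖ / ℓ) ^ 2 / 4 = ν * ‖x‖ ^ 2 / (2 * ℓ ^ 2) := by
      rw [div_pow, mul_pow, Real.sq_sqrt (by positivity)]
      field_simp
      ring
    rw [e]
    have : (2 : ℝ) ^ (ν - 1) ≠ 0 := by positivity
    rw [← mul_assoc, one_div, mul_inv, mul_assoc _ _ ((2 : ℝ) ^ (ν - 1)), inv_mul_cancel₀ this,
      mul_one]

theorem gaussian_sum_nonneg {d : ℕ} {ι : Type*} (S : Finset ι) (c : ι → ℝ)
    (x : ι → EuclideanSpace ℝ (Fin d)) {a : ℝ} (ha : 0 ≤ a) :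
    0 ≤ ∑ i ∈ S, ∑ j ∈ S, c i * c j * Real.exp (-(a * ‖x i - x j‖ ^ 2)) := by
  let E := EuclideanSpace ℝ (Fin d)
  let e : ι → E → ℂ := fun i w => Complex.exp (inner ℝ w (√(2 * a) • x i) * Complex.I)
  have he : ∀ i j w, e i w * (starRingEnd ℂ) (e j w) =
      Complex.exp (inner ℝ w (√(2 * a) • (x i - x j)) * Complex.I) := by
    intro i j w
    simp only [e, ← Complex.exp_conj, ← Complex.exp_add]
    congr 1
    simp [smul_sub, inner_sub_right]
    ring
  have hval : ∀ i j, ∫ w, e i w * (starRingEnd ℂ) (e j w) ∂(stdGaussian E) =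
      (Real.exp (-(a * ‖x i - x j‖ ^ 2)) : ℂ) := by
    intro i j
    simp only [he]
    rw [← charFun_apply, charFun_stdGaussian, norm_smul]
    push_cast
    congr 1
    rw [mul_pow, ← Complex.ofReal_pow, Real.norm_eq_abs, sq_abs, Real.sq_sqrt (by positivity)]
    push_cast
    ring
  have hint : ∀ i j, Integrable (fun w => e i w * (starRingEnd ℂ) (e j w)) (stdGaussian E) := by
    intro i j
    simp only [he]
    refine Integrable.of_bound (C := 1) (by fun_prop) (Eventually.of_forall fun w => ?_)
    rw [Complex.norm_exp_ofReal_mul_I]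
  have hsq : ∀ w, ∑ i ∈ S, ∑ j ∈ S, (c i * c j : ℂ) * (e i w * (starRingEnd ℂ) (e j w)) =
      ((‖∑ i ∈ S, (c i : ℂ) * e i w‖ ^ 2 : ℝ) : ℂ) := by
    intro w
    rw [Complex.ofReal_pow, ← Complex.mul_conj', map_sum, Finset.sum_mul_sum]
    refine Finset.sum_congr rfl fun i _ => Finset.sum_congr rfl fun j _ => ?_
    simp
    ring
  have hmain : ((∑ i ∈ S, ∑ j ∈ S, c i * c j * Real.exp (-(a * ‖x i - x j‖ ^ 2)) : ℝ) : ℂ) =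
      ((∫ w, ‖∑ i ∈ S, (c i : ℂ) * e i w‖ ^ 2 ∂(stdGaussian E) : ℝ) : ℂ) := by
    rw [← integral_complex_ofReal]
    simp_rw [← hsq]
    rw [integral_finsetSum _ fun i _ => integrable_finsetSum _ fun j _ => (hint i j).const_mul _]
    push_cast
    refine Finset.sum_congr rfl fun i _ => ?_
    rw [integral_finsetSum _ fun j _ => (hint i j).const_mul _]
    refine Finset.sum_congr rfl fun j _ => ?_
    rw [integral_const_mul, hval]
    push_cast
    rfl
  rw [Complex.ofReal_inj.mp hmain]
  positivity

/-- The kernel `k(x, y) = Ψ(x - y)` on `Ω`. Mathlib's kernels are operator valued: the real number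
`k(x, y)` is represented by multiplication with it. -/
def maternKernel {d : ℕ} (ν ℓ : ℝ) (Ω : Set (EuclideanSpace ℝ (Fin d))) :
    Matrix Ω Ω (ℝ →L[ℝ] ℝ) :=
  Matrix.of fun x y => matern ν ℓ (x.1 - y.1) • ContinuousLinearMap.id ℝ ℝ

theorem matern_neg {d : ℕ} (ν ℓ : ℝ) (x : EuclideanSpace ℝ (Fin d)) :
    matern ν ℓ (-x) = matern ν ℓ x := by
  simp [matern]

theorem matern_sum_nonneg {d : ℕ} {ν ℓ : ℝ} (hν : 0 < ν) (hℓ : 0 < ℓ) {ι : Type*} (S : Finset ι)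
    (c : ι → ℝ) (x : ι → EuclideanSpace ℝ (Fin d)) :
    0 ≤ ∑ i ∈ S, ∑ j ∈ S, c i * c j * matern ν ℓ (x i - x j) := by
  have hI : ∀ i j, IntegrableOn (fun s : ℝ => Real.exp (-s) * s ^ (ν - 1) *
      Real.exp (-(ν * ‖x i - x j‖ ^ 2 / (2 * ℓ ^ 2)) / s)) (Ioi 0) := fun i j =>
    integrableOn_maternMixture hν (by positivity)
  have h : ∑ i ∈ S, ∑ j ∈ S, c i * c j * matern ν ℓ (x i - x j) =
      (Real.Gamma ν)⁻¹ * ∫ s in Ioi (0 : ℝ), Real.exp (-s) * s ^ (ν - 1) *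
        ∑ i ∈ S, ∑ j ∈ S, c i * c j *
          Real.exp (-(ν / (2 * ℓ ^ 2 * s) * ‖x i - x j‖ ^ 2)) := by
    have e : ∀ s : ℝ, Real.exp (-s) * s ^ (ν - 1) * ∑ i ∈ S, ∑ j ∈ S, c i * c j *
          Real.exp (-(ν / (2 * ℓ ^ 2 * s) * ‖x i - x j‖ ^ 2)) =
        ∑ i ∈ S, ∑ j ∈ S, c i * c j * (Real.exp (-s) * s ^ (ν - 1) *
          Real.exp (-(ν * ‖x i - x j‖ ^ 2 / (2 * ℓ ^ 2)) / s)) := by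
      intro s
      simp only [Finset.mul_sum]
      refine Finset.sum_congr rfl fun i _ => Finset.sum_congr rfl fun j _ => ?_
      have : -(ν / (2 * ℓ ^ 2 * s) * ‖x i - x j‖ ^ 2)
          = -(ν * ‖x i - x j‖ ^ 2 / (2 * ℓ ^ 2)) / s := by
        rw [neg_div, div_div, div_mul_eq_mul_div]
      rw [this]
      ring
    simp_rw [e]
    rw [integral_finsetSum _ fun i _ => integrable_finsetSum _ fun j _ => (hI i j).const_mul _,
      Finset.mul_sum]
    refine Finset.sum_congr rfl fun i _ => ?_
    rw [integral_finsetSum _ fun j _ => (hI i j).const_mul _, Finset.mul_sum]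
    refine Finset.sum_congr rfl fun j _ => ?_
    rw [integral_const_mul, matern_eq_mixture hν hℓ]
    ring
  rw [h]
  refine mul_nonneg (inv_nonneg.mpr (Real.Gamma_pos_of_pos hν).le) ?_
  refine setIntegral_nonneg measurableSet_Ioi fun s hs => ?_
  have hs' : (0 : ℝ) < s := hs
  exact mul_nonneg (by positivity) (gaussian_sum_nonneg S c x (by positivity))

theorem maternKernel_posSemidef {d : ℕ} {ν ℓ : ℝ} (hν : 0 < ν) (hℓ : 0 < ℓ)
    (Ω : Set (EuclideanSpace ℝ (Fin d))) : (maternKernel ν ℓ Ω).PosSemidef := by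
  have herm : (maternKernel ν ℓ Ω).IsHermitian := by
    refine Matrix.IsHermitian.ext fun x y => ?_
    have h1 : star (ContinuousLinearMap.id ℝ ℝ) = ContinuousLinearMap.id ℝ ℝ := star_one _
    simp only [maternKernel, Matrix.of_apply, star_smul, h1, star_trivial]
    rw [← neg_sub, matern_neg]
  have htfae := (RKHS.posSemidef_tfae (K := maternKernel ν ℓ Ω)).out 0 2
  refine htfae.mpr ⟨herm, fun v => ?_⟩
  have := matern_sum_nonneg hν hℓ v.support v (fun x : Ω => (x : EuclideanSpace ℝ (Fin d)))
  simp only [RCLike.re_to_real, Finsupp.sum, maternKernel, Matrix.of_apply]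
  rw [Finset.sum_comm]
  refine this.trans_eq (Finset.sum_congr rfl fun i _ => Finset.sum_congr rfl fun j _ => ?_)
  simp
  ring

instance instFactMaternKernelPosSemidef {d : ℕ} {ν ℓ : ℝ} [hν : Fact (0 < ν)] [hℓ : Fact (0 < ℓ)]
    (Ω : Set (EuclideanSpace ℝ (Fin d))) : Fact (maternKernel ν ℓ Ω).PosSemidef :=
  ⟨maternKernel_posSemidef hν.out hℓ.out Ω⟩

/-- The reproducing kernel Hilbert space of the Matérn kernel on `Ω`: the completion of the span of
the functions `k(·, x)`, `x ∈ Ω`, for the inner product `⟪k(·, x), k(·, y)⟫ = k(x, y)`. Its elements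
are functions on `Ω`: `g x` is the value of `g` at `x : Ω`. -/
abbrev MaternRKHS {d : ℕ} (ν ℓ : ℝ) [Fact (0 < ν)] [Fact (0 < ℓ)]
    (Ω : Set (EuclideanSpace ℝ (Fin d))) : Type :=
  RKHS.OfKernel (maternKernel ν ℓ Ω)

/-- The regularized least squares functional of kernel ridge regression. -/
def krrObjective {d : ℕ} {ν ℓ : ℝ} [Fact (0 < ν)] [Fact (0 < ℓ)]
    {Ω : Set (EuclideanSpace ℝ (Fin d))} {n : ℕ} (lam : ℝ) (x : Fin n → Ω) (ybar : Fin n → ℝ)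
    (g : MaternRKHS ν ℓ Ω) : ℝ :=
  1 / n * ∑ i, (ybar i - g (x i)) ^ 2 + lam * ‖g‖ ^ 2

theorem existsUnique_krrMinimizer {d : ℕ} (ν ℓ : ℝ) [Fact (0 < ν)] [Fact (0 < ℓ)]
    {Ω : Set (EuclideanSpace ℝ (Fin d))} {n : ℕ} {lam : ℝ} (hlam : 0 < lam)
    (x : Fin n → Ω) (ybar : Fin n → ℝ) :
    ∃! g : MaternRKHS ν ℓ Ω, IsMinOn (krrObjective lam x ybar) univ g := by
  classical
  let H := MaternRKHS ν ℓ Ω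
  let k : Fin n → H := fun j => RKHS.kerFun H (x j) 1
  have hk : ∀ j (g : H), inner ℝ (k j) g = g (x j) := by
    intro j g
    simp [k]
  let c : ℝ := 1 / n
  have hc : 0 ≤ c := by positivity
  let G : Matrix (Fin n) (Fin n) ℝ := Matrix.gram ℝ k
  have hpd : (c • G + lam • (1 : Matrix (Fin n) (Fin n) ℝ)).PosDef :=
    Matrix.PosDef.posSemidef_add ((Matrix.posSemidef_gram ℝ k).smul hc)
      (Matrix.PosDef.one.smul hlam)
  let β : Fin n → ℝ := (c • G + lam • (1 : Matrix (Fin n) (Fin n) ℝ))⁻¹.mulVec (c • ybar)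
  have hβ : (c • G + lam • (1 : Matrix (Fin n) (Fin n) ℝ)).mulVec β = c • ybar := by
    simp only [β, Matrix.mulVec_mulVec]
    rw [Matrix.mul_nonsing_inv _ ((Matrix.isUnit_iff_isUnit_det _).mp hpd.isUnit), Matrix.one_mulVec]
  let g₀ : H := ∑ j, β j • k j
  have hg₀ : ∀ i, c * (ybar i - g₀ (x i)) = lam * β i := by
    intro i
    have h1 : g₀ (x i) = G.mulVec β i := by
      rw [← hk, inner_sum]
      simp only [Matrix.mulVec, dotProduct, inner_smul_right, G, Matrix.gram_apply]
      exact Finset.sum_congr rfl fun j _ => mul_comm _ _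
    have h2 := congrFun hβ i
    simp only [Matrix.add_mulVec, Matrix.smul_mulVec, Matrix.one_mulVec, Pi.add_apply,
      Pi.smul_apply, smul_eq_mul] at h2
    rw [h1]
    linarith
  have hJ : ∀ h : H, krrObjective lam x ybar (g₀ + h) = krrObjective lam x ybar g₀ +
      (c * ∑ i, (h (x i)) ^ 2 + lam * ‖h‖ ^ 2) := by
    intro h
    have h1 : inner ℝ g₀ h = ∑ i, β i * h (x i) := by
      rw [show g₀ = ∑ j, β j • k j from rfl, sum_inner]
      refine Finset.sum_congr rfl fun i _ => ?_
      rw [inner_smul_left, hk]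
      rfl
    have h2 : ∑ i, c * (ybar i - (g₀ + h) (x i)) ^ 2 = ∑ i, c * (ybar i - g₀ (x i)) ^ 2 +
        ∑ i, c * (h (x i)) ^ 2 - 2 * (lam * ∑ i, β i * h (x i)) := by
      rw [Finset.mul_sum, Finset.mul_sum, ← Finset.sum_add_distrib, ← Finset.sum_sub_distrib]
      refine Finset.sum_congr rfl fun i _ => ?_
      rw [← mul_assoc lam, ← hg₀ i]
      simp only [RKHS.coe_add, Pi.add_apply]
      ring
    simp only [krrObjective]
    rw [norm_add_sq_real, h1]
    simp only [← Finset.mul_sum] at h2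
    change c * _ + _ = c * _ + _ + _
    rw [h2]
    ring
  have hmin : IsMinOn (krrObjective lam x ybar) univ g₀ := by
    intro g _
    have := hJ (g - g₀)
    rw [add_sub_cancel] at this
    have h3 : 0 ≤ c * ∑ i, ((g - g₀ : H) (x i)) ^ 2 + lam * ‖g - g₀‖ ^ 2 := by positivity
    simp only [mem_ofPred_eq]
    linarith
  refine ⟨g₀, hmin, fun g hg => ?_⟩
  have h4 : krrObjective lam x ybar g ≤ krrObjective lam x ybar g₀ := hg (mem_univ _)
  have := hJ (g - g₀)
  rw [add_sub_cancel] at this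
  have h5 : 0 ≤ c * ∑ i, ((g - g₀ : H) (x i)) ^ 2 := by positivity
  have h6 : lam * ‖g - g₀‖ ^ 2 ≤ 0 := by linarith
  have h7 : ‖g - g₀‖ ^ 2 ≤ 0 := by
    by_contra hcon
    push Not at hcon
    have := mul_pos hlam hcon
    linarith
  have h8 : ‖g - g₀‖ = 0 := by
    have := sq_nonneg ‖g - g₀‖
    exact pow_eq_zero_iff (two_ne_zero) |>.mp (le_antisymm h7 this)
  exact sub_eq_zero.mp (norm_eq_zero.mp h8)

/-- The kernel ridge regression estimator: the minimizer of the regularized least squares functional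
over the whole reproducing kernel Hilbert space. -/
def krrEstimator {d : ℕ} (ν ℓ : ℝ) [Fact (0 < ν)] [Fact (0 < ℓ)]
    {Ω : Set (EuclideanSpace ℝ (Fin d))} {n : ℕ} {lam : ℝ} (hlam : 0 < lam)
    (x : Fin n → Ω) (ybar : Fin n → ℝ) : MaternRKHS ν ℓ Ω :=
  (existsUnique_krrMinimizer ν ℓ hlam x ybar).choose

theorem krrEstimator_isMinOn {d : ℕ} (ν ℓ : ℝ) [Fact (0 < ν)] [Fact (0 < ℓ)]
    {Ω : Set (EuclideanSpace ℝ (Fin d))} {n : ℕ} {lam : ℝ} (hlam : 0 < lam)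
    (x : Fin n → Ω) (ybar : Fin n → ℝ) :
    IsMinOn (krrObjective lam x ybar) univ (krrEstimator ν ℓ hlam x ybar) :=
  (existsUnique_krrMinimizer ν ℓ hlam x ybar).choose_spec.1

/-- The averages `ȳ_i = m⁻¹ ∑_j (f(x_i) + ε_ij)` of the inner-level samples at the points `x_i`. -/
def sampleMeans {T : Type*} {n m : ℕ} (f : T → ℝ) (x : Fin n → T) (e : Fin n → Fin m → ℝ) :
    Fin n → ℝ :=
  fun i => 1 / m * ∑ j, (f (x i) + e i j)

/-- `Q`, a law of the noise matrix `(ε_ij)`, makes the entries independent, with mean zero and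
sub-Gaussian with variance proxy `v`, and identically distributed within each row. -/
structure IsNoiseLaw {n m : ℕ} (v : ℝ≥0) (Q : Measure (Fin n → Fin m → ℝ)) : Prop where
  indep : iIndepFun (fun (p : Fin n × Fin m) (e : Fin n → Fin m → ℝ) => e p.1 p.2) Q
  mean_zero : ∀ i j, ∫ e, e i j ∂Q = 0
  subGaussian : ∀ i j, HasSubgaussianMGF (fun e => e i j) v Q
  identDistrib : ∀ i j j', IdentDistrib (fun e => e i j) (fun e => e i j') Q Q

/-- `Ω` is bounded and convex, and `μ` is a law on `Ω` that has a density with respect to Lebesgue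
measure which is bounded above and bounded below away from zero on `Ω`. -/
structure IsDesignLaw {d : ℕ} (Ω : Set (EuclideanSpace ℝ (Fin d)))
    (μ : Measure (EuclideanSpace ℝ (Fin d))) : Prop where
  bounded : Bornology.IsBounded Ω
  convex : Convex ℝ Ω
  density : ∃ p : EuclideanSpace ℝ (Fin d) → ℝ, Measurable p ∧
    (∃ c C : ℝ, 0 < c ∧ ∀ x ∈ Ω, c ≤ p x ∧ p x ≤ C) ∧
    μ = (volume.restrict Ω).withDensity (fun x => ENNReal.ofReal (p x))

/-- `X = (x_1, …, x_n)` is a sample of independent points of `Ω` with the common law `μ`. -/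
structure IsIIDSample {d n : ℕ} {S : Type*} [MeasurableSpace S]
    {Ω : Set (EuclideanSpace ℝ (Fin d))} (μ : Measure (EuclideanSpace ℝ (Fin d)))
    (P : Measure S) (X : S → Fin n → Ω) : Prop where
  measurable : Measurable X
  indep : iIndepFun (fun i s => X s i) P
  law : ∀ i, P.map (fun s => (X s i : EuclideanSpace ℝ (Fin d))) = μ

/-- `a = O_P(b)` along the filter `l`: for every `ε > 0` there is `C > 0` such that
`P(a_k > C b_k) < ε` eventually along `l`. -/
def IsBigOP {κ S : Type*} [MeasurableSpace S] (P : Measure S) (l : Filter κ) (a : κ → S → ℝ)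
    (b : κ → ℝ) : Prop :=
  ∀ ε : ℝ, 0 < ε → ∃ C : ℝ, 0 < C ∧
    ∀ᶠ k in l, P {s | C * b k < a k s} < ENNReal.ofReal ε

end NestedKRR

end

open NestedKRR

/-! Kernel ridge regression is a linear smoother. With kernel matrix `K` and `M = n⁻¹ K + lam`, the
normal equation gives the residual `y - ĝ(x) = lam M⁻¹ y` (`regGramMatrix_mulVec_residual`). Put `w
i = φ (f (x i))` and let `e̅` be the row averages of the noise. Since `M` is symmetric, the weighted
error sum is `w · (lam M⁻¹ f(x)) - (w - lam M⁻¹ w) · e̅` (`abs_weighted_error_le`).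

The first term is the bias. Pairing `f` with the kernel expansion whose coefficients are `M⁻¹ f(x)`
gives `|lam M⁻¹ f(x)|² ≤ n lam ‖f‖² / 4` (`sum_sq_regGramMatrix_inv_mulVec_le`), so Cauchy–Schwarz
makes its average `O(lam ^ (1/2))`.

The second term is a linear form in the noise whose coefficients depend on the design alone. They
equal `n⁻¹ K M⁻¹ w`, a contraction of `w` (`sum_noiseWeights_sq_le`), so conditionally on the design
its average is sub-Gaussian with proxy at most `σ² B² / (n m)`, where `B` bounds `|w i|`. This holds
for every `lam`, with constants free of the design, so integrating the conditional tail bound gives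
the rate. Because the weights are known given the design, no uniform bound over a function class is
needed. -/

namespace NestedKRR

/-! ### Linear algebra of the regularized system `c K + lam`. -/

section RegularizedSystem

open Matrix

variable {n : ℕ} {K : Matrix (Fin n) (Fin n) ℝ} {c lam : ℝ}

theorem isUnit_det_smul_add_smul_one (hK : K.PosSemidef) (hc : 0 ≤ c) (hlam : 0 < lam) :
    IsUnit (c • K + lam • (1 : Matrix (Fin n) (Fin n) ℝ)).det :=
  (Matrix.isUnit_iff_isUnit_det _).mp
    (Matrix.PosDef.posSemidef_add (hK.smul hc) (Matrix.PosDef.one.smul hlam)).isUnit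

theorem dotProduct_mulVec_self_nonneg (hK : K.PosSemidef) (u : Fin n → ℝ) : 0 ≤ u ⬝ᵥ K *ᵥ u := by
  simpa using hK.dotProduct_mulVec_nonneg u

/-- The smoothing matrix `c K (c K + lam)⁻¹` is a contraction. -/
theorem dotProduct_self_sub_smul_le (hK : K.PosSemidef) (hc : 0 ≤ c) (hlam : 0 < lam)
    {u y : Fin n → ℝ} (h : (c • K + lam • (1 : Matrix (Fin n) (Fin n) ℝ)) *ᵥ u = y) :
    (y - lam • u) ⬝ᵥ (y - lam • u) ≤ y ⬝ᵥ y := by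
  have hq := dotProduct_mulVec_self_nonneg hK u
  have h1 : y = c • (K *ᵥ u) + lam • u := by
    rw [← h, add_mulVec, smul_mulVec, smul_mulVec, one_mulVec]
  have h2 : y - lam • u = c • (K *ᵥ u) := by rw [h1]; simp
  have h3 : 0 ≤ u ⬝ᵥ u := by simpa using dotProduct_star_self_nonneg u
  rw [h2, h1]
  simp only [dotProduct_add, add_dotProduct, smul_dotProduct, dotProduct_smul, smul_eq_mul,
    dotProduct_comm (K *ᵥ u) u]
  -- The gap between the two sides is `2 lam c (u · K u) + lam² (u · u)`.
  have h4 := mul_nonneg hlam.le (mul_nonneg hc hq)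
  have h5 := mul_nonneg (mul_nonneg hlam.le hlam.le) h3
  nlinarith

theorem transpose_inv_smul_add_smul_one (hK : K.PosSemidef) :
    ((c • K + lam • (1 : Matrix (Fin n) (Fin n) ℝ))⁻¹)ᵀ =
      (c • K + lam • (1 : Matrix (Fin n) (Fin n) ℝ))⁻¹ := by
  have : Kᵀ = K := by simpa using hK.isHermitian.eq
  rw [transpose_nonsing_inv]
  simp [this]

/-- By Cramer's rule an entry of the inverse is a quotient of polynomials in the entries. Singular
matrices do no harm, as both inverses are then zero by convention. -/
theorem measurable_inv_apply {T : Type*} [MeasurableSpace T] {M : T → Matrix (Fin n) (Fin n) ℝ}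
    (hM : ∀ i j, Measurable fun t => M t i j) (i j : Fin n) :
    Measurable fun t => (M t)⁻¹ i j := by
  have hdet : ∀ N : T → Matrix (Fin n) (Fin n) ℝ, (∀ i j, Measurable fun t => N t i j) →
      Measurable fun t => (N t).det := by
    intro N hN
    simp only [det_apply]
    exact Finset.measurable_sum _ fun σ _ =>
      (Finset.measurable_prod _ fun i _ => hN _ _).const_smul _
  simp only [inv_def, Ring.inverse_eq_inv', Matrix.smul_apply, adjugate_apply, smul_eq_mul]
  refine (hdet M hM).inv.mul (hdet _ fun a b => ?_)
  simp only [updateRow_apply]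
  split_ifs
  · exact measurable_const
  · exact hM a b

end RegularizedSystem

/-! ### Measurability in the design, normal equation, and bias–noise decomposition. -/

section Estimator

open Matrix

variable {d : ℕ} {ν ℓ : ℝ} [Fact (0 < ν)] [Fact (0 < ℓ)] {Ω : Set (EuclideanSpace ℝ (Fin d))}

/-- The Gaussian mixture formula covers the origin as well, and its integrand is jointly measurable
in the point and the mixing variable. -/
theorem measurable_matern : Measurable (matern ν ℓ : EuclideanSpace ℝ (Fin d) → ℝ) := by
  have h : (matern ν ℓ : EuclideanSpace ℝ (Fin d) → ℝ) = fun x =>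
      (Real.Gamma ν)⁻¹ * ∫ s in Ioi (0 : ℝ), Real.exp (-s) * s ^ (ν - 1) *
        Real.exp (-(ν * ‖x‖ ^ 2 / (2 * ℓ ^ 2)) / s) :=
    funext fun x => matern_eq_mixture Fact.out Fact.out x
  rw [h]
  refine Measurable.const_mul (StronglyMeasurable.integral_prod_right
    (f := fun (x : EuclideanSpace ℝ (Fin d)) (s : ℝ) => Real.exp (-s) * s ^ (ν - 1) *
        Real.exp (-(ν * ‖x‖ ^ 2 / (2 * ℓ ^ 2)) / s)) ?_).measurable _
  refine Measurable.stronglyMeasurable ?_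
  simp only [Function.uncurry_def]
  fun_prop

theorem kerFun_one_apply (x y : Ω) :
    RKHS.kerFun (MaternRKHS ν ℓ Ω) y (1 : ℝ) x = matern ν ℓ (x.1 - y.1) := by
  rw [RKHS.kerFun_apply, RKHS.OfKernel.kernel_ofKernel]
  simp [maternKernel]

theorem inner_kerFun_one (x : Ω) (g : MaternRKHS ν ℓ Ω) :
    inner ℝ (RKHS.kerFun (MaternRKHS ν ℓ Ω) x (1 : ℝ)) g = g x := by
  simp

/-- Kernel sections span a dense subspace and evaluations are continuous, so every element is a
pointwise limit of measurable functions. -/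
theorem measurable_coe_maternRKHS (f : MaternRKHS ν ℓ Ω) : Measurable (f : Ω → ℝ) := by
  have hspan : ∀ g ∈ Submodule.span ℝ
      {RKHS.kerFun (MaternRKHS ν ℓ Ω) x v | (x : Ω) (v : ℝ)}, Measurable (g : Ω → ℝ) := by
    intro g hg
    induction hg using Submodule.span_induction with
    | mem g hg =>
      obtain ⟨x, v, rfl⟩ := hg
      have : RKHS.kerFun (MaternRKHS ν ℓ Ω) x v = v • RKHS.kerFun (MaternRKHS ν ℓ Ω) x (1 : ℝ) := by
        rw [← map_smul]; simp
      rw [this, RKHS.coe_smul]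
      refine Measurable.const_smul ?_ v
      simp only [funext fun y => kerFun_one_apply (ν := ν) (ℓ := ℓ) y x]
      exact measurable_matern.comp (measurable_subtype_coe.sub_const _)
    | zero => rw [RKHS.coe_zero]; exact measurable_zero
    | add g h _ _ hg hh => rw [RKHS.coe_add]; exact hg.add hh
    | smul a g _ hg => rw [RKHS.coe_smul]; exact hg.const_smul a
  have hf : f ∈ closure (Submodule.span ℝ
      {RKHS.kerFun (MaternRKHS ν ℓ Ω) x v | (x : Ω) (v : ℝ)} : Set (MaternRKHS ν ℓ Ω)) := by
    rw [← Submodule.topologicalClosure_coe, RKHS.kerFun_dense]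
    trivial
  obtain ⟨g, hg, hgf⟩ := mem_closure_iff_seq_limit.mp hf
  exact measurable_of_tendsto_metrizable (fun k => hspan _ (hg k)) (tendsto_pi_nhds.mpr fun x =>
    ((RKHS.continuous_eval x).tendsto f).comp hgf)

/-- The kernel matrix of the design points `x`. -/
noncomputable def gramMatrix (ν ℓ : ℝ) {n : ℕ} (x : Fin n → Ω) : Matrix (Fin n) (Fin n) ℝ :=
  Matrix.of fun i j => matern ν ℓ ((x i).1 - (x j).1)

theorem gramMatrix_eq_gram {n : ℕ} (x : Fin n → Ω) :
    gramMatrix ν ℓ x =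
      Matrix.gram ℝ fun i => RKHS.kerFun (MaternRKHS ν ℓ Ω) (x i) (1 : ℝ) := by
  ext i j
  rw [Matrix.gram_apply, inner_kerFun_one, kerFun_one_apply]
  rfl

theorem gramMatrix_posSemidef {n : ℕ} (x : Fin n → Ω) :
    (gramMatrix ν ℓ x).PosSemidef := by
  rw [gramMatrix_eq_gram]
  exact Matrix.posSemidef_gram ℝ _

theorem measurable_gramMatrix_apply {n : ℕ} (i j : Fin n) :
    Measurable fun x : Fin n → Ω => gramMatrix ν ℓ x i j := by
  simp only [gramMatrix, Matrix.of_apply]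
  refine measurable_matern.comp (Measurable.sub ?_ ?_)
  · exact measurable_subtype_coe.comp (measurable_pi_apply i)
  · exact measurable_subtype_coe.comp (measurable_pi_apply j)

theorem sum_smul_kerFun_apply {n : ℕ} (x : Fin n → Ω) (u : Fin n → ℝ) (i : Fin n) :
    (∑ j, u j • RKHS.kerFun (MaternRKHS ν ℓ Ω) (x j) (1 : ℝ)) (x i) =
      (gramMatrix ν ℓ x *ᵥ u) i := by
  rw [← inner_kerFun_one, inner_sum, gramMatrix_eq_gram]
  simp only [Matrix.mulVec, dotProduct, inner_smul_right, Matrix.gram_apply]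
  exact Finset.sum_congr rfl fun j _ => mul_comm _ _

/-- The regularized kernel matrix `n⁻¹ K + lam`. -/
noncomputable def regGramMatrix (ν ℓ lam : ℝ) {n : ℕ} (x : Fin n → Ω) : Matrix (Fin n) (Fin n) ℝ :=
  (1 / n : ℝ) • gramMatrix ν ℓ x + lam • 1

theorem isUnit_det_regGramMatrix {lam : ℝ} (hlam : 0 < lam) {n : ℕ} (x : Fin n → Ω) :
    IsUnit (regGramMatrix ν ℓ lam x).det :=
  isUnit_det_smul_add_smul_one (gramMatrix_posSemidef x) (by positivity) hlam

/-- The normal equation of kernel ridge regression. -/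
theorem krrEstimator_stationary {n : ℕ} {lam : ℝ} (hlam : 0 < lam) (x : Fin n → Ω)
    (y : Fin n → ℝ) (h : MaternRKHS ν ℓ Ω) :
    1 / n * ∑ i, (y i - krrEstimator ν ℓ hlam x y (x i)) * h (x i) =
      lam * inner ℝ (krrEstimator ν ℓ hlam x y) h := by
  set g := krrEstimator ν ℓ hlam x y with hg
  set L := lam * inner ℝ g h - 1 / n * ∑ i, (y i - g (x i)) * h (x i) with hL
  set q := 1 / n * ∑ i, (h (x i)) ^ 2 + lam * ‖h‖ ^ 2 with hq
  have hexp : ∀ t : ℝ, krrObjective lam x y (g + t • h) =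
      krrObjective lam x y g + 2 * t * L + t ^ 2 * q := by
    intro t
    have h1 : ∑ i, (y i - (g + t • h) (x i)) ^ 2 = ∑ i, (y i - g (x i)) ^ 2 -
        2 * t * ∑ i, (y i - g (x i)) * h (x i) + t ^ 2 * ∑ i, (h (x i)) ^ 2 := by
      rw [Finset.mul_sum, Finset.mul_sum, ← Finset.sum_sub_distrib, ← Finset.sum_add_distrib]
      refine Finset.sum_congr rfl fun i _ => ?_
      simp only [RKHS.coe_add, RKHS.coe_smul, Pi.add_apply, Pi.smul_apply, smul_eq_mul]
      ring
    simp only [krrObjective]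
    rw [h1, norm_add_sq_real, inner_smul_right, norm_smul, mul_pow, Real.norm_eq_abs, sq_abs,
      hL, hq]
    ring
  -- Minimality along the line `g + t • h` leaves a nonnegative quadratic in `t` without constant
  -- term; its discriminant `4 L²` must vanish.
  have hmin : ∀ t : ℝ, 0 ≤ q * (t * t) + 2 * L * t + 0 := by
    intro t
    have h2 : krrObjective lam x y g ≤ krrObjective lam x y (g + t • h) :=
      krrEstimator_isMinOn ν ℓ hlam x y (mem_univ _)
    rw [hexp] at h2
    linarith
  have hdisc := discrim_le_zero hmin
  have h3 : L = 0 := by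
    rw [discrim] at hdisc
    nlinarith [sq_nonneg L]
  linarith

/-- The normal equation tested against the kernel sections at the design points, where the inner
product with the estimator becomes its value. -/
theorem regGramMatrix_mulVec_residual {n : ℕ} {lam : ℝ} (hlam : 0 < lam) (x : Fin n → Ω)
    (y : Fin n → ℝ) :
    regGramMatrix ν ℓ lam x *ᵥ (fun i => y i - krrEstimator ν ℓ hlam x y (x i)) = lam • y := by
  set g := krrEstimator ν ℓ hlam x y with hg
  ext j
  have h := krrEstimator_stationary hlam x y (RKHS.kerFun (MaternRKHS ν ℓ Ω) (x j) (1 : ℝ))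
  rw [← hg, real_inner_comm, inner_kerFun_one] at h
  have hsum : ∑ i, (y i - g (x i)) * RKHS.kerFun (MaternRKHS ν ℓ Ω) (x j) (1 : ℝ) (x i) =
      (gramMatrix ν ℓ x *ᵥ fun i => y i - g (x i)) j := by
    simp only [Matrix.mulVec, dotProduct]
    refine Finset.sum_congr rfl fun i _ => ?_
    rw [kerFun_one_apply, gramMatrix, Matrix.of_apply, ← neg_sub (x j).1, matern_neg, mul_comm]
  rw [hsum] at h
  simp only [regGramMatrix, add_mulVec, smul_mulVec, one_mulVec, Pi.add_apply, Pi.smul_apply,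
    smul_eq_mul]
  rw [h]
  ring

/-- The weights with which the noise enters a weighted sum of the fitted values: the values of the
weight vector `w`, smoothed by kernel ridge regression. -/
noncomputable def noiseWeights (ν ℓ lam : ℝ) {n : ℕ} (x : Fin n → Ω) (w : Fin n → ℝ) : Fin n → ℝ :=
  w - lam • ((regGramMatrix ν ℓ lam x)⁻¹ *ᵥ w)

/-- The weights are `n⁻¹ K M⁻¹ w`, and `n⁻¹ K M⁻¹` has its spectrum in `[0, 1)`. -/
theorem sum_noiseWeights_sq_le {lam : ℝ} (hlam : 0 < lam) {n : ℕ} (x : Fin n → Ω)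
    (w : Fin n → ℝ) :
    ∑ i, noiseWeights ν ℓ lam x w i ^ 2 ≤ ∑ i, w i ^ 2 := by
  have h := dotProduct_self_sub_smul_le (gramMatrix_posSemidef (ν := ν) (ℓ := ℓ) x)
    (c := (1 / n : ℝ)) (by positivity) hlam (u := (regGramMatrix ν ℓ lam x)⁻¹ *ᵥ w) (y := w)
    (by
      change regGramMatrix ν ℓ lam x *ᵥ _ = w
      rw [mulVec_mulVec, mul_nonsing_inv _ (isUnit_det_regGramMatrix hlam x), one_mulVec])
  simpa only [noiseWeights, dotProduct, ← sq] using h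

/-- Makes the noise event jointly measurable in design and noise, so that it can be disintegrated
over the design. -/
theorem measurable_noiseWeights {lam : ℝ} {n : ℕ} {w : (Fin n → Ω) → Fin n → ℝ}
    (hw : ∀ i, Measurable fun x => w x i) (i : Fin n) :
    Measurable fun x : Fin n → Ω => noiseWeights ν ℓ lam x (w x) i := by
  simp only [noiseWeights, Pi.sub_apply, Pi.smul_apply, Matrix.mulVec, dotProduct, smul_eq_mul]
  refine (hw i).sub (Measurable.const_mul (Finset.measurable_sum _ fun j _ =>
    (measurable_inv_apply (fun a b => ?_) i j).mul (hw j)) _)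
  simp only [regGramMatrix, Matrix.add_apply, Matrix.smul_apply, smul_eq_mul]
  exact ((measurable_gramMatrix_apply a b).const_mul _).add measurable_const

/-- The residual of kernel ridge regression on noiseless data. -/
theorem sum_sq_regGramMatrix_inv_mulVec_le {lam : ℝ} (hlam : 0 < lam) {n : ℕ} (hn : 0 < n)
    (x : Fin n → Ω) (f : MaternRKHS ν ℓ Ω) :
    ∑ i, (lam * ((regGramMatrix ν ℓ lam x)⁻¹ *ᵥ fun i => f (x i)) i) ^ 2 ≤
      n * lam * ‖f‖ ^ 2 / 4 := by
  set u := (regGramMatrix ν ℓ lam x)⁻¹ *ᵥ fun i => f (x i) with hu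
  have hn' : (0 : ℝ) < n := by exact_mod_cast hn
  have hMu : regGramMatrix ν ℓ lam x *ᵥ u = fun i => f (x i) := by
    rw [hu, mulVec_mulVec, mul_nonsing_inv _ (isUnit_det_regGramMatrix hlam x), one_mulVec]
  set g : MaternRKHS ν ℓ Ω := ∑ j, u j • RKHS.kerFun (MaternRKHS ν ℓ Ω) (x j) (1 : ℝ) with hg
  have hgf : ∀ h : MaternRKHS ν ℓ Ω, inner ℝ g h = ∑ i, u i * h (x i) := by
    intro h
    rw [hg, sum_inner]
    refine Finset.sum_congr rfl fun i _ => ?_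
    rw [inner_smul_left, inner_kerFun_one]
    rfl
  have hfx : ∀ i, f (x i) = 1 / n * g (x i) + lam * u i := by
    intro i
    have := congrFun hMu i
    simp only [regGramMatrix, add_mulVec, smul_mulVec, one_mulVec, Pi.add_apply, Pi.smul_apply,
      smul_eq_mul] at this
    rw [hg, sum_smul_kerFun_apply, this]
  -- Pairing with `g` sees only values at the design points, where `f` is `n⁻¹ g + lam u`.
  have h1 : inner ℝ g f = 1 / n * ‖g‖ ^ 2 + lam * ∑ i, u i ^ 2 := by
    rw [← real_inner_self_eq_norm_sq, hgf, hgf, Finset.mul_sum, Finset.mul_sum,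
      ← Finset.sum_add_distrib]
    refine Finset.sum_congr rfl fun i _ => ?_
    rw [hfx i]
    ring
  have h2 : inner ℝ g f ≤ ‖g‖ * ‖f‖ := real_inner_le_norm g f
  have h3 : lam * ∑ i, u i ^ 2 ≤ n * ‖f‖ ^ 2 / 4 := by
    -- Completing the square: `n ‖f‖² / 4` is the maximum of `t ‖f‖ - t² / n` over `t`.
    have h4 : (n : ℝ) * ‖f‖ ^ 2 / 4 - (‖g‖ * ‖f‖ - 1 / n * ‖g‖ ^ 2) =
        (n * ‖f‖ / 2 - ‖g‖) ^ 2 / n := by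
      field_simp
      ring
    have h5 : 0 ≤ (n * ‖f‖ / 2 - ‖g‖) ^ 2 / n := by positivity
    linarith
  simp only [mul_pow, ← Finset.mul_sum]
  calc lam ^ 2 * ∑ i, u i ^ 2 = lam * (lam * ∑ i, u i ^ 2) := by ring
    _ ≤ lam * (n * ‖f‖ ^ 2 / 4) := by gcongr
    _ = _ := by ring

/-- Bias and noise decomposition of the weighted error of kernel ridge regression. -/
theorem abs_weighted_error_le {lam : ℝ} (hlam : 0 < lam) {n m : ℕ} (hn : 0 < n) (hm : 0 < m)
    (x : Fin n → Ω) (f : MaternRKHS ν ℓ Ω) (e : Fin n → Fin m → ℝ) {w : Fin n → ℝ} {B : ℝ}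
    (hB : 0 ≤ B) (hw : ∀ i, |w i| ≤ B) :
    |1 / (n : ℝ) * ∑ i, w i * (f (x i) - krrEstimator ν ℓ hlam x (sampleMeans f x e) (x i))| ≤
      B * ‖f‖ * √lam +
        |1 / (n : ℝ) * ∑ i, noiseWeights ν ℓ lam x w i * (1 / m * ∑ j, e i j)| := by
  have hn' : (0 : ℝ) < n := by exact_mod_cast hn
  have hm' : (m : ℝ) ≠ 0 := by exact_mod_cast hm.ne'
  set M := regGramMatrix ν ℓ lam x with hM
  set fx : Fin n → ℝ := fun i => f (x i) with hfx
  set ebar : Fin n → ℝ := fun i => 1 / m * ∑ j, e i j with hebar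
  have hy : sampleMeans f x e = fx + ebar := by
    ext i
    simp only [sampleMeans, Finset.sum_add_distrib, Finset.sum_const, Finset.card_univ,
      Fintype.card_fin, nsmul_eq_mul, hfx, hebar, Pi.add_apply]
    field_simp
  set y := sampleMeans f x e with hydef
  set r : Fin n → ℝ := fun i => y i - krrEstimator ν ℓ hlam x y (x i) with hr
  have hMr : r = lam • (M⁻¹ *ᵥ y) := by
    rw [← mulVec_smul, ← regGramMatrix_mulVec_residual (ν := ν) (ℓ := ℓ) hlam x y, mulVec_mulVec,
      nonsing_inv_mul _ (isUnit_det_regGramMatrix hlam x), one_mulVec]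
  -- Symmetry moves the smoothing from the noise to `w`, which is fixed given the design.
  have hsymm : w ⬝ᵥ M⁻¹ *ᵥ ebar = (M⁻¹ *ᵥ w) ⬝ᵥ ebar := by
    rw [dotProduct_mulVec, ← mulVec_transpose, hM, regGramMatrix,
      transpose_inv_smul_add_smul_one (gramMatrix_posSemidef x)]
  have hdec : ∑ i, w i * (f (x i) - krrEstimator ν ℓ hlam x y (x i)) =
      w ⬝ᵥ (lam • (M⁻¹ *ᵥ fx)) - noiseWeights ν ℓ lam x w ⬝ᵥ ebar := by
    have h1 : ∑ i, w i * (f (x i) - krrEstimator ν ℓ hlam x y (x i)) = w ⬝ᵥ (r - ebar) := by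
      refine Finset.sum_congr rfl fun i _ => ?_
      rw [Pi.sub_apply, hr]
      simp only [hy, Pi.add_apply, hfx]
      ring
    rw [h1, hMr, hy, noiseWeights, mulVec_add, smul_add, dotProduct_sub, dotProduct_add,
      sub_dotProduct, smul_dotProduct, dotProduct_smul lam w (M⁻¹ *ᵥ ebar), hsymm]
    ring
  have hbias : |1 / (n : ℝ) * w ⬝ᵥ (lam • (M⁻¹ *ᵥ fx))| ≤ B * ‖f‖ * √lam := by
    refine abs_le_of_sq_le_sq ?_ (by positivity)
    have hcs : (w ⬝ᵥ (lam • (M⁻¹ *ᵥ fx))) ^ 2 ≤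
        (∑ i, w i ^ 2) * ∑ i, (lam * (M⁻¹ *ᵥ fx) i) ^ 2 :=
      Finset.sum_mul_sq_le_sq_mul_sq _ _ _
    have hw2 : ∑ i, w i ^ 2 ≤ n * B ^ 2 := by
      calc ∑ i, w i ^ 2 ≤ ∑ _i : Fin n, B ^ 2 :=
            Finset.sum_le_sum fun i _ => sq_le_sq' (abs_le.mp (hw i)).1 (abs_le.mp (hw i)).2
        _ = _ := by simp
    have hres := sum_sq_regGramMatrix_inv_mulVec_le (ν := ν) (ℓ := ℓ) hlam hn x f
    calc (1 / (n : ℝ) * w ⬝ᵥ (lam • (M⁻¹ *ᵥ fx))) ^ 2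
        = (1 / n) ^ 2 * (w ⬝ᵥ (lam • (M⁻¹ *ᵥ fx))) ^ 2 := by ring
      _ ≤ (1 / n) ^ 2 * ((n * B ^ 2) * (n * lam * ‖f‖ ^ 2 / 4)) := by
          gcongr
          exact hcs.trans (mul_le_mul hw2 hres (Finset.sum_nonneg fun _ _ => sq_nonneg _)
            (by positivity))
      _ = B ^ 2 * ‖f‖ ^ 2 * lam / 4 := by field_simp
      _ ≤ B ^ 2 * ‖f‖ ^ 2 * lam := by
          have : 0 ≤ B ^ 2 * ‖f‖ ^ 2 * lam := by positivity
          linarith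
      _ = (B * ‖f‖ * √lam) ^ 2 := by rw [mul_pow, mul_pow, Real.sq_sqrt hlam.le]
  rw [hdec, mul_sub]
  refine (abs_sub _ _).trans (add_le_add hbias le_rfl)

end Estimator

/-! ### Conditional sub-Gaussian tails and their integration over the design. -/

section Noise

theorem _root_.ProbabilityTheory.HasSubgaussianMGF.mono {T : Type*} [MeasurableSpace T]
    {Q : Measure T} {Z : T → ℝ} {c c' : ℝ≥0} (h : HasSubgaussianMGF Z c Q) (hcc : c ≤ c') :
    HasSubgaussianMGF Z c' Q where
  integrable_exp_mul := h.integrable_exp_mul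
  mgf_le t := (h.mgf_le t).trans (by gcongr)

theorem IsNoiseLaw.isProbabilityMeasure {n m : ℕ} {v : ℝ≥0} {Q : Measure (Fin n → Fin m → ℝ)}
    (hQ : IsNoiseLaw v Q) : IsProbabilityMeasure Q := hQ.indep.isProbabilityMeasure

/-- The average is a sum of `n m` independent terms `a i / (n m) * e i j`, whose proxies add up to
at most `V / (n m)`. The threshold is `D` times the square root of `1 / (n m)`, so the sample sizes
cancel in the exponent of the two-sided Chernoff bound. -/
theorem IsNoiseLaw.measure_abs_weighted_mean_ge_le {n m : ℕ} {v : ℝ≥0}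
    {Q : Measure (Fin n → Fin m → ℝ)} (hQ : IsNoiseLaw v Q) (hn : 0 < n) (hm : 0 < m)
    {a : Fin n → ℝ} {V : ℝ} (hV : v * ∑ i, a i ^ 2 ≤ n * V) {D : ℝ} (hD : 0 ≤ D) :
    Q {e | D * ((m : ℝ) * n) ^ (-(1 / 2) : ℝ) ≤
        |1 / (n : ℝ) * ∑ i, a i * (1 / m * ∑ j, e i j)|} ≤
      ENNReal.ofReal (2 * Real.exp (-D ^ 2 / (2 * V))) := by
  have := hQ.isProbabilityMeasure
  have hn' : (0 : ℝ) < n := by exact_mod_cast hn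
  have hm' : (0 : ℝ) < m := by exact_mod_cast hm
  have hV0 : 0 ≤ V := by
    have : 0 ≤ n * V := le_trans (by positivity) hV
    exact nonneg_of_mul_nonneg_right this hn'
  set Z : (Fin n → Fin m → ℝ) → ℝ := fun e =>
    ∑ p : Fin n × Fin m, a p.1 / (n * m) * e p.1 p.2 with hZ
  have hZeq : ∀ e : Fin n → Fin m → ℝ,
      1 / (n : ℝ) * ∑ i, a i * (1 / m * ∑ j, e i j) = Z e := by
    intro e
    simp only [hZ, Fintype.sum_prod_type, Finset.mul_sum]
    refine Finset.sum_congr rfl fun i _ => Finset.sum_congr rfl fun j _ => ?_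
    field_simp
  have hind : iIndepFun (fun (p : Fin n × Fin m) (e : Fin n → Fin m → ℝ) =>
      a p.1 / (n * m) * e p.1 p.2) Q :=
    hQ.indep.comp (fun p t => a p.1 / (n * m) * t) fun p => by fun_prop
  have hsub := HasSubgaussianMGF.sum_of_iIndepFun hind (s := Finset.univ)
    fun p _ => ((hQ.subGaussian p.1 p.2).const_mul (a p.1 / (n * m))).mono
      (c' := Real.toNNReal ((a p.1 / (n * m)) ^ 2) * v)
      (by rw [Real.toNNReal_of_nonneg (sq_nonneg _)]; exact le_of_eq rfl)
  obtain ⟨V', rfl⟩ : ∃ V' : ℝ≥0, (V' : ℝ) = V := ⟨⟨V, hV0⟩, rfl⟩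
  have hsubV : HasSubgaussianMGF Z (V' / (n * m)) Q := by
    refine hsub.mono ?_
    rw [← NNReal.coe_le_coe]
    simp only [NNReal.coe_sum, NNReal.coe_mul, Real.coe_toNNReal _ (sq_nonneg _), NNReal.coe_div, NNReal.coe_natCast,
      Fintype.sum_prod_type, Finset.sum_const, Finset.card_univ, Fintype.card_fin, nsmul_eq_mul]
    calc _ = (v * ∑ i, a i ^ 2) / (n ^ 2 * m) := by
            rw [Finset.mul_sum, Finset.sum_div]
            refine Finset.sum_congr rfl fun i _ => ?_
            field_simp
      _ ≤ (n * V') / (n ^ 2 * m) := by gcongr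
      _ = _ := by field_simp
  set τ := D * ((m : ℝ) * n) ^ (-(1 / 2) : ℝ) with hτ
  have hτ0 : 0 ≤ τ := by positivity
  have hτ2 : -τ ^ 2 / (2 * ((V' / (n * m) : ℝ≥0) : ℝ)) = -D ^ 2 / (2 * V') := by
    have : (((m : ℝ) * n) ^ (-(1 / 2) : ℝ)) ^ 2 = ((m : ℝ) * n)⁻¹ := by
      rw [← Real.rpow_natCast, ← Real.rpow_mul (by positivity), ← Real.rpow_neg_one]
      norm_num
    rw [hτ, mul_pow, this]
    push_cast
    rcases eq_or_ne (V' : ℝ) 0 with h0 | h0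
    -- With `V' = 0` both exponents are `0`, as division by zero gives zero.
    · simp [h0]
    · field_simp
  have h1 := hsubV.measure_ge_le hτ0
  have h2 := hsubV.neg.measure_ge_le hτ0
  rw [hτ2] at h1 h2
  simp only [hZeq]
  have hset : {e | τ ≤ |Z e|} ⊆ {e | τ ≤ Z e} ∪ {e | τ ≤ (-Z) e} := by
    intro e he
    rcases le_abs.mp (show τ ≤ |Z e| from he) with h | h
    · exact Or.inl h
    · exact Or.inr h
  refine (measure_mono hset).trans ((measure_union_le _ _).trans ?_)
  rw [two_mul, ENNReal.ofReal_add (by positivity) (by positivity)]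
  refine add_le_add ?_ ?_
  · rw [← ofReal_measureReal]
    exact ENNReal.ofReal_le_ofReal h1
  · rw [← ofReal_measureReal]
    exact ENNReal.ofReal_le_ofReal h2

/-- An event that is unlikely under almost every conditional law is unlikely. -/
theorem measure_prodMk_preimage_le {S T U : Type*} [MeasurableSpace S] [MeasurableSpace T]
    [MeasurableSpace U] [StandardBorelSpace U] [Nonempty U] {P : Measure S} [IsProbabilityMeasure P]
    {X : S → T} {Y : S → U} (hX : Measurable X) (hY : Measurable Y) {E : Set (T × U)}
    (hE : MeasurableSet E) {δ : ℝ≥0∞}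
    (h : ∀ᵐ x ∂(P.map X), condDistrib Y X P x (Prod.mk x ⁻¹' E) ≤ δ) :
    P {s | (X s, Y s) ∈ E} ≤ δ := by
  have := Measure.isProbabilityMeasure_map (μ := P) hX.aemeasurable
  calc P {s | (X s, Y s) ∈ E} = (P.map fun s => (X s, Y s)) E :=
        (Measure.map_apply (hX.prodMk hY) hE).symm
    _ = ∫⁻ x, condDistrib Y X P x (Prod.mk x ⁻¹' E) ∂(P.map X) := by
        rw [← compProd_map_condDistrib hY.aemeasurable, Measure.compProd_apply hE]
    _ ≤ ∫⁻ _, δ ∂(P.map X) := lintegral_mono_ae h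
    _ = δ := by simp

/-- Tail bound for the weighted error of kernel ridge regression at a fixed sample size. -/
theorem measure_weighted_error_gt_le {d : ℕ} {ν ℓ : ℝ} [Fact (0 < ν)] [Fact (0 < ℓ)]
    {Ω : Set (EuclideanSpace ℝ (Fin d))} (f : MaternRKHS ν ℓ Ω) {φ : ℝ → ℝ} (hφ : Measurable φ)
    {B : ℝ} (hB : 0 ≤ B) (hφB : ∀ x : Ω, |φ (f x)| ≤ B) {S : Type*} [MeasurableSpace S]
    {P : Measure S} [IsProbabilityMeasure P] {n m : ℕ} (hn : 0 < n) (hm : 0 < m) {lam : ℝ}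
    (hlam : 0 < lam) {X : S → Fin n → Ω} (hX : Measurable X) {noise : S → Fin n → Fin m → ℝ}
    (hnoise_meas : Measurable noise) {v : ℝ≥0}
    (hnoise : ∀ᵐ x ∂(P.map X), IsNoiseLaw v (condDistrib noise X P x))
    {D : ℝ} (hD : 0 ≤ D) (hfD : B * ‖f‖ ≤ D) {V : ℝ} (hV : v * B ^ 2 ≤ V) :
    P {s | D * (lam ^ (1 / 2 : ℝ) + ((m : ℝ) * (n : ℝ)) ^ (-(1 / 2) : ℝ)) <
      |1 / (n : ℝ) * ∑ i, φ (f (X s i)) * (f (X s i) -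
        krrEstimator ν ℓ hlam (X s) (sampleMeans f (X s) (noise s)) (X s i))|} ≤
      ENNReal.ofReal (2 * Real.exp (-D ^ 2 / (2 * V))) := by
  let w : (Fin n → Ω) → Fin n → ℝ := fun x i => φ (f (x i))
  have hw : ∀ i, Measurable fun x => w x i := fun i =>
    hφ.comp ((measurable_coe_maternRKHS f).comp (measurable_pi_apply i))
  have hwB : ∀ x i, |w x i| ≤ B := fun x i => hφB (x i)
  let E : Set ((Fin n → Ω) × (Fin n → Fin m → ℝ)) :=
    {p | D * ((m : ℝ) * n) ^ (-(1 / 2) : ℝ) ≤ |1 / (n : ℝ) *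
      ∑ i, noiseWeights ν ℓ lam p.1 (w p.1) i * (1 / m * ∑ j, p.2 i j)|}
  have hE : MeasurableSet E := by
    refine measurableSet_le measurable_const (Measurable.abs (Measurable.const_mul
      (Finset.measurable_sum _ fun i _ => ?_) _))
    exact ((measurable_noiseWeights hw i).comp measurable_fst).mul (by fun_prop)
  -- The bias uses up at most `D * √lam` of the threshold, so the excess falls on the noise term.
  -- Only the larger event `E`, free of the estimator, has to be measurable.
  have hsub : {s | D * (lam ^ (1 / 2 : ℝ) + ((m : ℝ) * (n : ℝ)) ^ (-(1 / 2) : ℝ)) <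
      |1 / (n : ℝ) * ∑ i, φ (f (X s i)) * (f (X s i) -
        krrEstimator ν ℓ hlam (X s) (sampleMeans f (X s) (noise s)) (X s i))|} ⊆
      {s | (X s, noise s) ∈ E} := by
    intro s hs
    have h1 := abs_weighted_error_le hlam hn hm (X s) f (noise s) hB (hwB (X s))
    have h2 := lt_of_lt_of_le (mem_ofPred_eq ▸ hs) h1
    have h3 : B * ‖f‖ * √lam ≤ D * √lam := by gcongr
    rw [← Real.sqrt_eq_rpow, mul_add] at h2
    have h4 : D * ((m : ℝ) * n) ^ (-(1 / 2) : ℝ) ≤ |1 / (n : ℝ) *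
      ∑ i, noiseWeights ν ℓ lam (X s) (w (X s)) i * (1 / m * ∑ j, noise s i j)| := by linarith
    exact h4
  refine (measure_mono hsub).trans (measure_prodMk_preimage_le hX hnoise_meas hE ?_)
  filter_upwards [hnoise] with x hx
  have hsq : ∑ i, w x i ^ 2 ≤ n * B ^ 2 := by
    calc ∑ i, w x i ^ 2 ≤ ∑ _i : Fin n, B ^ 2 := Finset.sum_le_sum fun i _ =>
          sq_le_sq' (abs_le.mp (hwB x i)).1 (abs_le.mp (hwB x i)).2
      _ = _ := by simp
  have hwV : v * ∑ i, noiseWeights ν ℓ lam x (w x) i ^ 2 ≤ n * V := by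
    calc (v : ℝ) * ∑ i, noiseWeights ν ℓ lam x (w x) i ^ 2
        ≤ v * (n * B ^ 2) :=
          mul_le_mul_of_nonneg_left ((sum_noiseWeights_sq_le hlam x (w x)).trans hsq) v.coe_nonneg
      _ = n * (v * B ^ 2) := by ring
      _ ≤ n * V := mul_le_mul_of_nonneg_left hV n.cast_nonneg
  exact hx.measure_abs_weighted_mean_ge_le hn hm hwV hD

end Noise

end NestedKRR

theorem proposition1 {d : ℕ} (ν ℓ : ℝ) [Fact (0 < ν)] [Fact (0 < ℓ)]
    {Ω : Set (EuclideanSpace ℝ (Fin d))} {μ : Measure (EuclideanSpace ℝ (Fin d))}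
    (hμ : IsDesignLaw Ω μ)
    (f : MaternRKHS ν ℓ Ω)
    (φ : ℝ → ℝ) (hφ_meas : Measurable φ) (hφ_bdd : ∃ B : ℝ, ∀ x : Ω, |φ (f x)| ≤ B)
    {S : Type*} [MeasurableSpace S] (P : Measure S) [IsProbabilityMeasure P]
    {κ : Type*} (l : Filter κ) (n m : κ → ℕ) (lam : κ → ℝ)
    (hn : Tendsto n l atTop) (hm : ∀ k, 0 < m k) (hlam : ∀ k, 0 < lam k)
    (X : ∀ k, S → Fin (n k) → Ω) (hX : ∀ k, IsIIDSample μ P (X k))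
    (noise : ∀ k, S → Fin (n k) → Fin (m k) → ℝ) (hnoise_meas : ∀ k, Measurable (noise k))
    (v : ℝ≥0)
    (hnoise : ∀ k, ∀ᵐ x ∂(P.map (X k)), IsNoiseLaw v (condDistrib (noise k) (X k) P x)) :
    IsBigOP P l
      (fun k s =>
        |1 / (n k : ℝ) * ∑ i, φ (f (X k s i)) *
          (f (X k s i) -
            krrEstimator ν ℓ (hlam k) (X k s) (sampleMeans f (X k s) (noise k s)) (X k s i))|)
      (fun k => lam k ^ (1 / 2 : ℝ) + ((m k : ℝ) * (n k : ℝ)) ^ (-(1 / 2) : ℝ)) := by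
  obtain ⟨B₀, hB₀⟩ := hφ_bdd
  obtain ⟨B, hB, hφB⟩ : ∃ B : ℝ, 0 ≤ B ∧ ∀ x : Ω, |φ (f x)| ≤ B :=
    ⟨|B₀|, abs_nonneg _, fun x => (hB₀ x).trans (le_abs_self _)⟩
  intro ε hε
  -- The `+ 1` keeps `V` positive when `v` or `B` vanishes, so that the exponent below tends to
  -- `-∞`.
  set V : ℝ := v * B ^ 2 + 1 with hV
  have hVpos : 0 < V := by positivity
  -- A large `D` makes the noise tail smaller than `ε` and dominates the bias constant `B * ‖f‖`;
  -- the `+ 1` here makes `D` positive. Neither demand involves `k`.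
  obtain ⟨D, hDε, hDf⟩ : ∃ D : ℝ, 2 * Real.exp (-D ^ 2 / (2 * V)) < ε ∧ B * ‖f‖ + 1 ≤ D := by
    have h1 : Tendsto (fun D : ℝ => 2 * Real.exp (-D ^ 2 / (2 * V))) atTop (𝓝 (2 * 0)) := by
      refine Tendsto.const_mul 2 (Real.tendsto_exp_atBot.comp ?_)
      refine Tendsto.atBot_div_const (by positivity) ?_
      exact tendsto_neg_atTop_atBot.comp (tendsto_pow_atTop two_ne_zero)
    rw [mul_zero] at h1
    exact ((h1.eventually (gt_mem_nhds hε)).and (eventually_ge_atTop _)).exists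
  have hBf : 0 ≤ B * ‖f‖ := by positivity
  have hD : 0 < D := by linarith
  refine ⟨D, hD, ?_⟩
  filter_upwards [hn.eventually_gt_atTop 0] with k hnk
  exact (measure_weighted_error_gt_le f hφ_meas hB hφB hnk (hm k) (hlam k) (hX k).measurable
    (hnoise_meas k) (hnoise k) hD.le (by linarith) (by linarith)).trans_lt
    ((ENNReal.ofReal_lt_ofReal_iff hε).mpr hDε)
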